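/- Let $D$ be the open unit disc in the plane. For $u:D\to\mathbb R$ and $0\le r<1$ write $u_r(\theta)=u(re^{i\theta})$. Let $\|u_r\|_p$ denote the $L^p$ norm of $u_r$ over $[-\pi,\pi]$ with respect to Lebesgue measure $d\theta$, and let $\|u_r\|=\sup_I\left|\int_I u_r\right|$ denote its Alexiewicz norm, the supremum being over all intervals $I\subset\mathbb R$ of length at most $2\pi$. Let $h^{\mathcal{HK}}$ be the space of functions $u:D\to\mathbb R$ that are harmonic in $D$ and satisfy $\|u\|_{\mathcal{HK}}:=\sup_{0\le r<1}\|u_r\|<\infty$. **Theorem.** Let $1\le p\le\infty$, and read $(2\pi)^{1/p}$ as $1$ when $p=\infty$. If $u\in h^{\mathcal{HK}}$, then $$\|u_r\|_p\le(2\pi)^{1/p}\,\frac{2r\,\|u\|_{\mathcal{HK}}}{\pi(1-r)}\quad\text{for }\tfrac12\le r<1,\qquad \|u_r\|_p\le(2\pi)^{1/p}\,\frac{2\,\|u\|_{\mathcal{HK}}}{\pi}\quad\text{for }0\le r\le\tfrac12 .$$ The resulting order relation $\|u_r\|_p=O(1/(1-r))$ is sharp as $r\to1$ in the following sense. For every $1\le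 p\le\infty$ and every $\psi:[0,1)\to(0,\infty)$ with $\psi(r)=o(1/(1-r))$ as $r\to1^-$, there is $u\in h^{\mathcal{HK}}$ with $\limsup_{r\to1^-}\|u_r\|_p/\psi(r)=\infty$. For $p=\infty$, moreover, there are $u\in h^{\mathcal{HK}}$ and $c>0$ such that $\|u_r\|_\infty\ge c/(1-r)$ for all $0\le r<1$. -/

import Mathlib

open Filter Topology MeasureTheory Asymptotics
open scoped ENNReal

/-- The slice `u_r(θ) = u(r e^{iθ})` of a function `u` on the unit disc. -/
noncomputable def slice (u : ℂ → ℝ) (r : ℝ) : ℝ → ℝ :=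
  fun θ => u ((r : ℂ) * Complex.exp ((θ : ℂ) * Complex.I))

/-- The Alexiewicz norm `‖f‖ = sup_I |∫_I f|` of a continuous `2π`-periodic function `f`, the
supremum being over all intervals `I` of length at most `2π`. It takes values in `[0, ∞]`. It is
only used for continuous `f` (slices of harmonic functions); for these the Lebesgue integral over
a bounded interval exists and equals the Henstock–Kurzweil integral. -/
noncomputable def alexiewiczNorm (f : ℝ → ℝ) : ℝ≥0∞ :=
  ⨆ (a : ℝ) (b : ℝ) (_ : a ≤ b ∧ b - a ≤ 2 * Real.pi), ENNReal.ofReal |∫ t in a..b, f t|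

/-- `‖u‖_HK = sup_{0 ≤ r < 1} ‖u_r‖`, with values in `[0, ∞]`. -/
noncomputable def hkNorm (u : ℂ → ℝ) : ℝ≥0∞ :=
  ⨆ (r : ℝ) (_ : 0 ≤ r ∧ r < 1), alexiewiczNorm (slice u r)

/-- The harmonic Hardy space `h^HK`: functions harmonic in the open unit disc with
`‖u‖_HK < ∞`. Values of `u` outside the disc are irrelevant. -/
def harmonicHardyHK : Set (ℂ → ℝ) :=
  {u | InnerProductSpace.HarmonicOnNhd u (Metric.ball (0 : ℂ) 1) ∧ hkNorm u < ∞}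

/-- `‖u_r‖_p`, the `L^p` norm of `u_r` over one period with respect to Lebesgue measure `dθ`
(not normalised). -/
noncomputable def sliceLpNorm (u : ℂ → ℝ) (p : ℝ≥0∞) (r : ℝ) : ℝ≥0∞ :=
  eLpNorm (slice u r) p (volume.restrict (Set.Ioc (-Real.pi) Real.pi))

open scoped Classical in
/-- The factor `(2π)^{1/p}`, read as `1` when `p = ∞`. -/
noncomputable def periodFactor (p : ℝ≥0∞) : ℝ :=
  if p = ∞ then 1 else (2 * Real.pi) ^ (1 / p.toReal)

/-! Upper bound: write `u (s r e^{iθ})` as the Poisson integral of `u_s` and integrate by parts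
against the primitive of `u_s` over `[θ - x, θ + x]`, which `‖u‖_HK` bounds for `0 ≤ x ≤ π`. The
kernel is even and decreasing on `[0, π]`, so its end value plus its variation is its peak `(1 + r)
/ (1 - r)`. Letting `s → 1` gives the pointwise bound `abs_slice_le`, and every `L^p` bound follows.

Sharpness for `p = ∞`: the Poisson kernel `Re ((1 + z) / (1 - z))` is positive with mean 1 and peaks
at `(1 + r) / (1 - r)`.

Sharpness for every `p`: `n r ^ n cos (n θ)` has integrals at most 2 over all intervals, yet size
comparable to `1 / (1 - r)` at `r = 1 - 1 / (2 n)`. Summing such terms with summable weights `b k`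
stays in the space (`gapSeries_re_mem`). The Fourier coefficient at frequency `n k` bounds the norm
below (`ofReal_le_sliceLpNorm_gapSeries`), and choosing `n k` large defeats `ψ`. -/

/-! ### Slices and the Alexiewicz–Hardy norm. -/

theorem circle_mem_ball {r : ℝ} (h0 : 0 ≤ r) (h1 : r < 1) (θ : ℝ) :
    (r : ℂ) * Complex.exp ((θ : ℂ) * Complex.I) ∈ Metric.ball (0 : ℂ) 1 := by
  simpa [Complex.norm_exp_ofReal_mul_I, abs_of_nonneg h0] using h1

theorem slice_continuous {u : ℂ → ℝ} (hu : ContinuousOn u (Metric.ball 0 1)) {r : ℝ}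
    (h0 : 0 ≤ r) (h1 : r < 1) : Continuous (slice u r) :=
  hu.comp_continuous (by fun_prop) (circle_mem_ball h0 h1)

theorem slice_periodic (u : ℂ → ℝ) (r : ℝ) : Function.Periodic (slice u r) (2 * Real.pi) := by
  intro θ
  simp only [slice]
  congr 2
  push_cast
  rw [add_mul, Complex.exp_add, Complex.exp_two_pi_mul_I, mul_one]

theorem abs_integral_le_hkNorm {u : ℂ → ℝ} (hu : hkNorm u < ∞) {r : ℝ} (h0 : 0 ≤ r) (h1 : r < 1)
    {a b : ℝ} (hab : a ≤ b) (hl : b - a ≤ 2 * Real.pi) :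
    |∫ t in a..b, slice u r t| ≤ (hkNorm u).toReal := by
  rw [← ENNReal.ofReal_le_iff_le_toReal hu.ne]
  refine le_trans ?_ (le_iSup₂_of_le (f := fun (r : ℝ) (_ : 0 ≤ r ∧ r < 1) =>
    alexiewiczNorm (slice u r)) r ⟨h0, h1⟩ le_rfl)
  exact le_iSup₂_of_le a b (le_iSup_of_le ⟨hab, hl⟩ le_rfl)

theorem hkNorm_le {u : ℂ → ℝ} {C : ℝ} (h : ∀ r : ℝ, 0 ≤ r → r < 1 → ∀ a b : ℝ, a ≤ b →
    b - a ≤ 2 * Real.pi → |∫ t in a..b, slice u r t| ≤ C) : hkNorm u ≤ ENNReal.ofReal C :=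
  iSup₂_le fun r hr => iSup₂_le fun a b => iSup_le fun hab =>
    ENNReal.ofReal_le_ofReal (h r hr.1 hr.2 a b hab.1 hab.2)

theorem mem_harmonicHardyHK_re {F : ℂ → ℂ} (hF : DifferentiableOn ℂ F (Metric.ball 0 1)) {C : ℝ}
    (h : ∀ r : ℝ, 0 ≤ r → r < 1 → ∀ a b : ℝ, a ≤ b → b - a ≤ 2 * Real.pi →
      |∫ t in a..b, slice (fun z => (F z).re) r t| ≤ C) :
    (fun z => (F z).re) ∈ harmonicHardyHK :=
  ⟨fun _ hz => (hF.analyticAt (Metric.isOpen_ball.mem_nhds hz)).harmonicAt_re,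
    (hkNorm_le h).trans_lt ENNReal.ofReal_lt_top⟩

/-! ### Pointwise bound from the Poisson integral. -/

/-- Integration by parts against an even kernel that decreases away from the origin. -/
theorem abs_integral_mul_le_of_even_of_deriv_nonpos {P P' f : ℝ → ℝ} {c θ A : ℝ} (hc : 0 ≤ c)
    (hP : ∀ x, HasDerivAt P (P' x) x) (hP' : Continuous P') (heven : ∀ x, P (-x) = P x)
    (hneg : ∀ x ∈ Set.Icc 0 c, P' x ≤ 0) (hPc : 0 ≤ P c) (hf : Continuous f)
    (hA : ∀ x ∈ Set.Icc 0 c, |∫ t in (θ - x)..(θ + x), f t| ≤ A) :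
    |∫ x in (-c)..c, P x * f (x + θ)| ≤ P 0 * A := by
  have hPcont : Continuous P := continuous_iff_continuousAt.2 fun x => (hP x).continuousAt
  set G : ℝ → ℝ := fun x => ∫ t in (θ - x)..(θ + x), f t with hG
  have hGd : ∀ x, HasDerivAt G (f (x + θ) + f (-x + θ)) x := by
    intro x
    have hF : ∀ y, HasDerivAt (fun y => ∫ t in θ..y, f t) (f y) y := fun y =>
      intervalIntegral.integral_hasDerivAt_right (hf.intervalIntegrable _ _)
        (hf.stronglyMeasurableAtFilter _ _) hf.continuousAt
    have e : G = fun x => (∫ t in θ..(θ + x), f t) - ∫ t in θ..(θ - x), f t := by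
      funext y
      rw [intervalIntegral.integral_interval_sub_left] <;> exact hf.intervalIntegrable _ _
    rw [e]
    have h1 := (hF (θ + x)).comp x ((hasDerivAt_id x).const_add θ)
    have h2 := (hF (θ - x)).comp x ((hasDerivAt_id x).const_sub θ)
    refine (h1.sub h2).congr_deriv ?_
    rw [add_comm θ x, neg_add_eq_sub]
    ring
  have hGcont : Continuous G := continuous_iff_continuousAt.2 fun x => (hGd x).continuousAt
  have hsym : ∫ x in (-c)..c, P x * f (x + θ) = ∫ x in 0..c, P x * (f (x + θ) + f (-x + θ)) := by
    have hc1 : Continuous fun x => P x * f (x + θ) := by fun_prop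
    have hc2 : Continuous fun x => P x * f (-x + θ) := by fun_prop
    have h := intervalIntegral.integral_comp_neg (a := 0) (b := c) fun x => P x * f (x + θ)
    rw [neg_zero] at h
    simp only [heven] at h
    rw [← intervalIntegral.integral_add_adjacent_intervals (hc1.intervalIntegrable (-c) 0)
      (hc1.intervalIntegrable 0 c), ← h, ← intervalIntegral.integral_add
      (hc2.intervalIntegrable 0 c) (hc1.intervalIntegrable 0 c)]
    refine intervalIntegral.integral_congr fun x _ => ?_
    ring
  have hparts := intervalIntegral.integral_mul_deriv_eq_deriv_mul (a := 0) (b := c)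
    (fun x _ => hP x) (fun x _ => hGd x) (hP'.intervalIntegrable _ _)
    (Continuous.intervalIntegrable (by fun_prop) _ _)
  have hG0 : G 0 = 0 := by simp [hG]
  have hint : ∫ x in 0..c, P' x = P c - P 0 :=
    intervalIntegral.integral_eq_sub_of_hasDerivAt (fun x _ => hP x) (hP'.intervalIntegrable _ _)
  have hrem : |∫ x in 0..c, P' x * G x| ≤ (P 0 - P c) * A := by
    have h1 : |∫ x in 0..c, P' x * G x| ≤ ∫ x in 0..c, -P' x * A := by
      refine (intervalIntegral.abs_integral_le_integral_abs hc).trans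
        (intervalIntegral.integral_mono_on hc
          (Continuous.intervalIntegrable (by fun_prop) _ _)
          (Continuous.intervalIntegrable (by fun_prop) _ _) fun x hx => ?_)
      rw [abs_mul, abs_of_nonpos (hneg x hx)]
      exact mul_le_mul_of_nonneg_left (hA x hx) (neg_nonneg.2 (hneg x hx))
    rwa [intervalIntegral.integral_mul_const, intervalIntegral.integral_neg, hint, neg_sub] at h1
  rw [hsym, hparts, hG0, mul_zero, sub_zero]
  calc |P c * G c - ∫ x in 0..c, P' x * G x| ≤ |P c * G c| + |∫ x in 0..c, P' x * G x| :=
        abs_sub _ _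
    _ ≤ P c * A + (P 0 - P c) * A := by
        rw [abs_mul, abs_of_nonneg hPc]
        exact add_le_add (mul_le_mul_of_nonneg_left (hA c ⟨hc, le_rfl⟩) hPc) hrem
    _ = P 0 * A := by ring

theorem poisson_denominator_pos {r : ℝ} (h0 : 0 ≤ r) (h1 : r < 1) (x : ℝ) :
    0 < 1 - 2 * r * Real.cos x + r ^ 2 := by
  nlinarith [mul_le_mul_of_nonneg_left (Real.cos_le_one x) h0, pow_pos (sub_pos.2 h1) 2]

/-- The Poisson integral formula on the circle of radius `s`, in real form. -/
theorem slice_mul_eq_integral_poisson {u : ℂ → ℝ}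
    (hu : InnerProductSpace.HarmonicOnNhd u (Metric.ball (0 : ℂ) 1)) {r s : ℝ} (hr0 : 0 ≤ r)
    (hr1 : r < 1) (hs0 : 0 < s) (hs1 : s < 1) (θ : ℝ) :
    slice u (s * r) θ = (2 * Real.pi)⁻¹ * ∫ x in (-Real.pi)..Real.pi,
      (1 - r ^ 2) / (1 - 2 * r * Real.cos x + r ^ 2) * slice u s (x + θ) := by
  set w : ℂ := ((s * r : ℝ) : ℂ) * Complex.exp ((θ : ℂ) * Complex.I) with hw
  have hwn : ‖w‖ = s * r := by
    rw [hw, norm_mul, Complex.norm_exp_ofReal_mul_I, mul_one, Complex.norm_real,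
      Real.norm_of_nonneg (by positivity)]
  have hwb : w ∈ Metric.ball (0 : ℂ) s := by
    rw [mem_ball_zero_iff, hwn]; nlinarith
  have h := InnerProductSpace.HarmonicOnNhd.circleAverage_poissonKernel_smul
    (hu.mono (Metric.closedBall_subset_ball hs1)) hwb
  change u w = _
  rw [← h, Real.circleAverage_def, smul_eq_mul]
  congr 1
  set g : ℝ → ℝ := fun t =>
    (1 - r ^ 2) / (1 - 2 * r * Real.cos (t - θ) + r ^ 2) * slice u s t with hg
  have hgp : Function.Periodic g (2 * Real.pi) := by
    intro t
    simp only [hg]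
    rw [slice_periodic u s t, add_sub_right_comm, Real.cos_add_two_pi]
  have e1 : ∀ t, (poissonKernel 0 w • u) (circleMap 0 s t) = g t := by
    intro t
    have hcm : circleMap 0 s t = (s : ℂ) * Complex.exp ((t : ℂ) * Complex.I) := by
      simp [circleMap]
    have hd : ‖circleMap 0 s t - w‖ ^ 2 = s ^ 2 * (1 - 2 * r * Real.cos (t - θ) + r ^ 2) := by
      rw [hcm, hw, ← Complex.normSq_eq_norm_sq, Complex.normSq_apply, Real.cos_sub,
        Complex.exp_mul_I, Complex.exp_mul_I, ← Complex.ofReal_cos, ← Complex.ofReal_sin,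
        ← Complex.ofReal_cos, ← Complex.ofReal_sin]
      simp only [Complex.sub_re, Complex.sub_im, Complex.mul_re, Complex.mul_im, Complex.add_re,
        Complex.add_im, Complex.ofReal_re, Complex.ofReal_im, Complex.I_re, Complex.I_im]
      linear_combination s ^ 2 * Real.sin_sq_add_cos_sq t
        + s ^ 2 * r ^ 2 * Real.sin_sq_add_cos_sq θ
    rw [Pi.smul_apply', smul_eq_mul, poissonKernel_def, sub_zero, sub_zero, hd, hwn, hg]
    simp only [slice, ← hcm]
    congr 1
    rw [norm_circleMap_zero, abs_of_pos hs0]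
    have := (poisson_denominator_pos hr0 hr1 (t - θ)).ne'
    field_simp
  simp only [e1]
  -- By periodicity the period is recentred at `θ`, where the kernel is even.
  have h2 := hgp.intervalIntegral_add_eq 0 (θ - Real.pi)
  rw [zero_add] at h2
  rw [h2]
  have h3 := intervalIntegral.integral_comp_add_right (a := -Real.pi) (b := Real.pi) g θ
  rw [show θ - Real.pi + 2 * Real.pi = Real.pi + θ by ring,
    show θ - Real.pi = -Real.pi + θ by ring, ← h3]
  simp [hg]

/-- The constant is the kernel's peak divided by `2π`. The auxiliary radius `s < 1` is needed
because `u` may have no boundary values. -/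
theorem abs_slice_mul_le {u : ℂ → ℝ} (hu : u ∈ harmonicHardyHK) {r s : ℝ} (hr0 : 0 ≤ r)
    (hr1 : r < 1) (hs0 : 0 < s) (hs1 : s < 1) (θ : ℝ) :
    |slice u (s * r) θ| ≤ (1 + r) / (2 * Real.pi * (1 - r)) * (hkNorm u).toReal := by
  have hf := slice_continuous hu.1.continuousOn hs0.le hs1
  have hpos := poisson_denominator_pos hr0 hr1
  have hr2 : 0 ≤ 1 - r ^ 2 := by nlinarith
  rw [slice_mul_eq_integral_poisson hu.1 hr0 hr1 hs0 hs1, abs_mul, abs_of_pos (by positivity)]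
  have hb := abs_integral_mul_le_of_even_of_deriv_nonpos (θ := θ) (A := (hkNorm u).toReal)
    (P := fun x => (1 - r ^ 2) / (1 - 2 * r * Real.cos x + r ^ 2))
    (P' := fun x => -((1 - r ^ 2) * (2 * r * Real.sin x)) / (1 - 2 * r * Real.cos x + r ^ 2) ^ 2)
    Real.pi_pos.le
    (fun x => by
      have h1 : HasDerivAt (fun x => 1 - 2 * r * Real.cos x + r ^ 2) (2 * r * Real.sin x) x := by
        refine ((((Real.hasDerivAt_cos x).const_mul (2 * r)).const_sub 1).add_const
          (r ^ 2)).congr_deriv ?_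
        ring
      refine ((hasDerivAt_const x (1 - r ^ 2)).div h1 (hpos x).ne').congr_deriv ?_
      ring)
    (by
      refine Continuous.div (by fun_prop) (by fun_prop) fun x => ?_
      exact pow_ne_zero 2 (hpos x).ne')
    (fun x => by simp)
    (fun x hx => by
      have := Real.sin_nonneg_of_nonneg_of_le_pi hx.1 hx.2
      exact div_nonpos_of_nonpos_of_nonneg (neg_nonpos.2 (by positivity)) (by positivity))
    (div_nonneg hr2 (hpos _).le) hf
    (fun x hx => abs_integral_le_hkNorm hu.2 hs0.le hs1 (by linarith [hx.1])
      (by linarith [hx.2]))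
  refine (mul_le_mul_of_nonneg_left hb (by positivity)).trans (le_of_eq ?_)
  rw [Real.cos_zero, ← mul_assoc]
  congr 1
  have h1 : 1 - r ≠ 0 := (sub_pos.2 hr1).ne'
  rw [show 1 - 2 * r * 1 + r ^ 2 = (1 - r) ^ 2 by ring,
    show 1 - r ^ 2 = (1 - r) * (1 + r) by ring]
  field_simp

theorem abs_slice_le {u : ℂ → ℝ} (hu : u ∈ harmonicHardyHK) {r : ℝ} (hr0 : 0 ≤ r)
    (hr1 : r < 1) (θ : ℝ) :
    |slice u r θ| ≤ (1 + r) / (2 * Real.pi * (1 - r)) * (hkNorm u).toReal := by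
  have hc : ContinuousAt (fun s : ℝ => slice u (s * r) θ) 1 := by
    have h1 : ContinuousAt u (((1 * r : ℝ) : ℂ) * Complex.exp ((θ : ℂ) * Complex.I)) :=
      hu.1.continuousOn.continuousAt
        (Metric.isOpen_ball.mem_nhds (circle_mem_ball (by simpa) (by simpa) θ))
    exact ContinuousAt.comp (f := fun s : ℝ =>
      ((s * r : ℝ) : ℂ) * Complex.exp ((θ : ℂ) * Complex.I)) h1 (by fun_prop)
  have ht : Tendsto (fun s : ℝ => |slice u (s * r) θ|) (𝓝[<] 1) (𝓝 |slice u r θ|) := by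
    have := hc.abs.tendsto.mono_left (nhdsWithin_le_nhds (s := Set.Iio 1))
    simpa using this
  refine le_of_tendsto ht ?_
  filter_upwards [Ioo_mem_nhdsLT (zero_lt_one' ℝ)] with s hs
  exact abs_slice_mul_le hu hr0 hr1 hs.1 hs.2 θ

/-! ### The `L^p` estimates. -/

theorem sliceLpNorm_le_of_abs_le {u : ℂ → ℝ} {p : ℝ≥0∞} {r C : ℝ}
    (h : ∀ θ, |slice u r θ| ≤ C) :
    sliceLpNorm u p r ≤ ENNReal.ofReal (periodFactor p) * ENNReal.ofReal C := by
  refine (eLpNorm_le_of_ae_bound (C := C) (ae_of_all _ h)).trans (le_of_eq ?_)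
  congr 1
  rw [Measure.restrict_apply_univ, Real.volume_Ioc, periodFactor,
    show Real.pi - -Real.pi = 2 * Real.pi by ring]
  split_ifs with hp
  · simp [hp]
  · rw [ENNReal.ofReal_rpow_of_pos (by positivity), one_div]

theorem periodFactor_nonneg (p : ℝ≥0∞) : 0 ≤ periodFactor p := by
  unfold periodFactor
  split_ifs <;> positivity

theorem sliceLpNorm_le {u : ℂ → ℝ} (hu : u ∈ harmonicHardyHK) (p : ℝ≥0∞) {r K : ℝ} (hr0 : 0 ≤ r)
    (hr1 : r < 1) (hK : (1 + r) / (2 * Real.pi * (1 - r)) ≤ K) :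
    sliceLpNorm u p r ≤ ENNReal.ofReal (periodFactor p * K) * hkNorm u := by
  refine (sliceLpNorm_le_of_abs_le fun θ => (abs_slice_le hu hr0 hr1 θ).trans
    (mul_le_mul_of_nonneg_right hK ENNReal.toReal_nonneg)).trans (le_of_eq ?_)
  have hK0 : 0 ≤ K := le_trans (by have := sub_pos.2 hr1; positivity) hK
  rw [ENNReal.ofReal_mul hK0, ENNReal.ofReal_toReal hu.2.ne,
    ENNReal.ofReal_mul (periodFactor_nonneg p), mul_assoc]

theorem sliceLpNorm_le_of_half_le {u : ℂ → ℝ} (hu : u ∈ harmonicHardyHK) (p : ℝ≥0∞) {r : ℝ}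
    (hr0 : 1 / 2 ≤ r) (hr1 : r < 1) :
    sliceLpNorm u p r ≤
      ENNReal.ofReal (periodFactor p * (2 * r / (Real.pi * (1 - r)))) * hkNorm u := by
  refine sliceLpNorm_le hu p (by linarith) hr1 ?_
  have := sub_pos.2 hr1
  rw [mul_assoc, ← div_div]
  gcongr
  -- What remains is `(1 + r) / 2 ≤ 2 r`, which already holds for `r ≥ 1 / 3`.
  linarith

theorem sliceLpNorm_le_of_le_half {u : ℂ → ℝ} (hu : u ∈ harmonicHardyHK) (p : ℝ≥0∞) {r : ℝ}
    (hr0 : 0 ≤ r) (hr1 : r ≤ 1 / 2) :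
    sliceLpNorm u p r ≤ ENNReal.ofReal (periodFactor p * (2 / Real.pi)) * hkNorm u := by
  refine sliceLpNorm_le hu p hr0 (by linarith) ?_
  have : 0 < 1 - r := by linarith
  rw [div_le_div_iff₀ (by positivity) Real.pi_pos]
  nlinarith [Real.pi_pos]

/-! ### Sharpness for `p = ∞`: the Poisson kernel. -/

/-- If the value at 0 exceeded the essential supremum, continuity would make it exceeded on an open
set of positive measure. -/
theorem ofReal_le_sliceLpNorm_top {u : ℂ → ℝ} {r c : ℝ} (hu : Continuous (slice u r))
    (hc : c ≤ slice u r 0) : ENNReal.ofReal c ≤ sliceLpNorm u ∞ r := by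
  rw [sliceLpNorm, eLpNorm_exponent_top]
  by_contra! h
  set μ := volume.restrict (Set.Ioc (-Real.pi) Real.pi)
  have hlt : eLpNormEssSup (slice u r) μ < ‖slice u r 0‖ₑ := by
    refine h.trans_le ?_
    rw [Real.enorm_eq_ofReal_abs]
    exact ENNReal.ofReal_le_ofReal (hc.trans (le_abs_self _))
  set U : Set ℝ := {x | eLpNormEssSup (slice u r) μ < ‖slice u r x‖ₑ} with hU
  have hUo : IsOpen U := isOpen_lt continuous_const hu.enorm
  have hz : μ U = 0 := meas_eLpNormEssSup_lt
  rw [Measure.restrict_apply hUo.measurableSet] at hz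
  refine ((hUo.inter isOpen_Ioo).measure_pos volume (U := U ∩ Set.Ioo (-Real.pi) Real.pi)
    ⟨0, hlt, neg_lt_zero.2 Real.pi_pos, Real.pi_pos⟩).ne' ?_
  exact measure_mono_null (Set.inter_subset_inter_right _ Set.Ioo_subset_Ioc_self) hz

theorem differentiableOn_one_add_div_one_sub :
    DifferentiableOn ℂ (fun z : ℂ => (1 + z) / (1 - z)) (Metric.ball 0 1) := by
  refine DifferentiableOn.div (by fun_prop) (by fun_prop) fun z hz h => ?_
  rw [← sub_eq_zero.1 h] at hz
  simp at hz

theorem re_one_add_div_one_sub_nonneg {z : ℂ} (hz : z ∈ Metric.ball (0 : ℂ) 1) :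
    0 ≤ ((1 + z) / (1 - z)).re := by
  rw [mem_ball_zero_iff] at hz
  have h : z.re * z.re + z.im * z.im < 1 := by
    rw [← Complex.normSq_apply, Complex.normSq_eq_norm_sq]
    nlinarith [norm_nonneg z]
  rw [Complex.div_re, ← add_div]
  refine div_nonneg ?_ (Complex.normSq_nonneg _)
  simp only [Complex.add_re, Complex.sub_re, Complex.add_im, Complex.sub_im, Complex.one_re,
    Complex.one_im]
  nlinarith

/-- A positive harmonic function has finite Alexiewicz–Hardy norm, by the mean value property. -/
theorem re_one_add_div_one_sub_mem :
    (fun z : ℂ => ((1 + z) / (1 - z)).re) ∈ harmonicHardyHK := by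
  refine mem_harmonicHardyHK_re differentiableOn_one_add_div_one_sub (C := 2 * Real.pi)
    fun r h0 h1 a b hab hl => ?_
  set u : ℂ → ℝ := fun z : ℂ => ((1 + z) / (1 - z)).re with hu
  have harm : InnerProductSpace.HarmonicOnNhd u (Metric.ball 0 1) := fun z hz =>
    (differentiableOn_one_add_div_one_sub.analyticAt
      (Metric.isOpen_ball.mem_nhds hz)).harmonicAt_re
  have hc := slice_continuous harm.continuousOn h0 h1
  have hn : ∀ t, 0 ≤ slice u r t := fun t =>
    re_one_add_div_one_sub_nonneg (circle_mem_ball h0 h1 t)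
  rw [abs_of_nonneg (intervalIntegral.integral_nonneg hab fun t _ => hn t)]
  have hm : Real.circleAverage u 0 r = u 0 := by
    refine InnerProductSpace.HarmonicOnNhd.circleAverage_eq
      (harm.mono (Metric.closedBall_subset_ball ?_))
    rwa [abs_of_nonneg h0]
  have h2 : ∫ t in a..(a + 2 * Real.pi), slice u r t = 2 * Real.pi := by
    rw [(slice_periodic u r).intervalIntegral_add_eq a 0, zero_add]
    rw [Real.circleAverage_def, smul_eq_mul, inv_mul_eq_iff_eq_mul₀ (by positivity)] at hm
    simpa [slice, circleMap, hu] using hm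
  rw [← h2]
  exact intervalIntegral.integral_mono_interval le_rfl hab (by linarith)
    (ae_of_all _ hn) (hc.intervalIntegrable _ _)

theorem exists_sliceLpNorm_top_ge :
    ∃ u ∈ harmonicHardyHK, ∃ c : ℝ, 0 < c ∧ ∀ r : ℝ, 0 ≤ r → r < 1 →
      ENNReal.ofReal (c / (1 - r)) ≤ sliceLpNorm u ∞ r := by
  refine ⟨_, re_one_add_div_one_sub_mem, 1, one_pos, fun r h0 h1 =>
    ofReal_le_sliceLpNorm_top
      (slice_continuous re_one_add_div_one_sub_mem.1.continuousOn h0 h1) ?_⟩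
  have e : slice (fun z : ℂ => ((1 + z) / (1 - z)).re) r 0 = (1 + r) / (1 - r) := by
    simp only [slice, Complex.ofReal_zero, zero_mul, Complex.exp_zero, mul_one]
    rw [← Complex.ofReal_re ((1 + r) / (1 - r))]
    push_cast
    rfl
  rw [e]
  exact div_le_div_of_nonneg_right (by linarith) (sub_pos.2 h1).le

/-! ### Gap series and their membership in the space. -/

theorem exists_natCast_mul_pow_le {ρ : ℝ} (h0 : 0 ≤ ρ) (h1 : ρ < 1) :
    ∃ C : ℝ, ∀ n : ℕ, n * ρ ^ n ≤ C := by
  have hs : Summable fun n : ℕ => (n : ℝ) * ρ ^ n := by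
    simpa using summable_pow_mul_geometric_of_norm_lt_one 1 (R := ℝ) (r := ρ)
      (by rwa [Real.norm_of_nonneg h0])
  exact ⟨_, fun n => hs.le_tsum n fun m _ => by positivity⟩

theorem summable_mul_natCast_mul_pow {b : ℕ → ℝ} (hb0 : ∀ k, 0 ≤ b k) (hb : Summable b)
    (n : ℕ → ℕ) {ρ : ℝ} (h0 : 0 ≤ ρ) (h1 : ρ < 1) :
    Summable fun k => b k * (n k * ρ ^ n k) := by
  obtain ⟨C, hC⟩ := exists_natCast_mul_pow_le h0 h1
  exact Summable.of_nonneg_of_le (fun k => mul_nonneg (hb0 k) (by positivity))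
    (fun k => mul_le_mul_of_nonneg_left (hC (n k)) (hb0 k)) (hb.mul_right C)

/-- The power series `∑ bₖ nₖ z ^ nₖ`. -/
noncomputable def gapSeries (b : ℕ → ℝ) (n : ℕ → ℕ) (z : ℂ) : ℂ :=
  ∑' k, (b k : ℂ) * (n k * z ^ n k)

theorem norm_gapSeries_term_le {b : ℕ → ℝ} (hb0 : ∀ k, 0 ≤ b k) (n : ℕ → ℕ) {ρ : ℝ} {z : ℂ}
    (hz : ‖z‖ ≤ ρ) (k : ℕ) : ‖(b k : ℂ) * (n k * z ^ n k)‖ ≤ b k * (n k * ρ ^ n k) := by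
  rw [norm_mul, norm_mul, norm_pow, Complex.norm_real, Real.norm_of_nonneg (hb0 k),
    Complex.norm_natCast]
  have := hb0 k
  gcongr

theorem differentiableOn_gapSeries {b : ℕ → ℝ} (hb0 : ∀ k, 0 ≤ b k) (hb : Summable b)
    (n : ℕ → ℕ) : DifferentiableOn ℂ (gapSeries b n) (Metric.ball 0 1) := by
  intro z hz
  obtain ⟨ρ, hzρ, hρ⟩ := exists_between (mem_ball_zero_iff.1 hz)
  have hd : DifferentiableOn ℂ (gapSeries b n) (Metric.ball 0 ρ) :=
    Complex.differentiableOn_tsum_of_summable_norm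
      (summable_mul_natCast_mul_pow hb0 hb n ((norm_nonneg z).trans hzρ.le) hρ)
      (fun k => by fun_prop) Metric.isOpen_ball
      (fun k w hw => norm_gapSeries_term_le hb0 n (mem_ball_zero_iff.1 hw).le k)
  exact (hd.differentiableAt
    (Metric.isOpen_ball.mem_nhds (mem_ball_zero_iff.2 hzρ))).differentiableWithinAt

theorem hasSum_slice_gapSeries {b : ℕ → ℝ} (hb0 : ∀ k, 0 ≤ b k) (hb : Summable b) (n : ℕ → ℕ)
    {r : ℝ} (h0 : 0 ≤ r) (h1 : r < 1) (θ : ℝ) :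
    HasSum (fun k => b k * (n k * r ^ n k) * Real.cos (n k * θ))
      (slice (fun z => (gapSeries b n z).re) r θ) := by
  have hs : Summable fun k => (b k : ℂ) *
      (n k * ((r : ℂ) * Complex.exp ((θ : ℂ) * Complex.I)) ^ n k) := by
    refine Summable.of_norm_bounded (summable_mul_natCast_mul_pow hb0 hb n h0 h1) fun k => ?_
    refine norm_gapSeries_term_le hb0 n (le_of_eq ?_) k
    rw [norm_mul, Complex.norm_exp_ofReal_mul_I, mul_one, Complex.norm_real,
      Real.norm_of_nonneg h0]
  convert Complex.hasSum_re hs.hasSum using 1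
  swap
  · rfl
  funext k
  have e : ((r : ℂ) * Complex.exp ((θ : ℂ) * Complex.I)) ^ n k
      = ((r ^ n k : ℝ) : ℂ) * Complex.exp (((n k * θ : ℝ) : ℂ) * Complex.I) := by
    rw [mul_pow, ← Complex.exp_nat_mul]
    push_cast
    rw [mul_assoc]
  rw [e, ← Complex.ofReal_natCast, Complex.re_ofReal_mul, Complex.re_ofReal_mul,
    Complex.re_ofReal_mul, Complex.exp_ofReal_mul_I_re]
  ring

theorem hasSum_integral_slice_gapSeries {b : ℕ → ℝ} (hb0 : ∀ k, 0 ≤ b k) (hb : Summable b)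
    (n : ℕ → ℕ) {r : ℝ} (h0 : 0 ≤ r) (h1 : r < 1) {g : ℝ → ℝ} (hg : Continuous g)
    (hg1 : ∀ x, |g x| ≤ 1) (a c : ℝ) :
    HasSum (fun k => b k * (n k * r ^ n k) * ∫ x in a..c, Real.cos (n k * x) * g x)
      (∫ x in a..c, slice (fun z => (gapSeries b n z).re) r x * g x) := by
  have hsum := summable_mul_natCast_mul_pow hb0 hb n h0 h1
  have h := intervalIntegral.hasSum_integral_of_dominated_convergence (a := a) (b := c)
    (μ := volume) (F := fun k x => b k * (n k * r ^ n k) * Real.cos (n k * x) * g x)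
    (f := fun x => slice (fun z => (gapSeries b n z).re) r x * g x)
    (fun k _ => b k * (n k * r ^ n k))
    (fun k => Continuous.aestronglyMeasurable (by fun_prop))
    (fun k => ae_of_all _ fun x _ => by
      have : 0 ≤ b k * (n k * r ^ n k) := mul_nonneg (hb0 k) (by positivity)
      rw [Real.norm_eq_abs, abs_mul, abs_mul, abs_of_nonneg this, mul_assoc]
      exact mul_le_of_le_one_right this
        (mul_le_one₀ (Real.abs_cos_le_one _) (abs_nonneg _) (hg1 x)))
    (ae_of_all _ fun x _ => hsum)
    intervalIntegrable_const
    (ae_of_all _ fun x _ => (hasSum_slice_gapSeries hb0 hb n h0 h1 x).mul_right _)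
  simpa only [mul_assoc, intervalIntegral.integral_const_mul] using h

theorem mul_abs_integral_cos_le (n : ℕ) (a c : ℝ) :
    n * |∫ x in a..c, Real.cos (n * x)| ≤ 2 := by
  rcases eq_or_ne n 0 with rfl | hn
  · simp
  · have hn' : (n : ℝ) ≠ 0 := Nat.cast_ne_zero.2 hn
    rw [intervalIntegral.integral_comp_mul_left _ hn', integral_cos, smul_eq_mul, abs_mul,
      abs_of_nonneg (by positivity), mul_inv_cancel_left₀ hn']
    refine (abs_sub _ _).trans ?_
    linarith [Real.abs_sin_le_one (n * c), Real.abs_sin_le_one (n * a)]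

/-- Integration gains a factor `1 / n k`, cancelling the coefficient `n k`, so the norm is at most
`2 ∑ b k` whatever the frequencies. -/
theorem gapSeries_re_mem {b : ℕ → ℝ} (hb0 : ∀ k, 0 ≤ b k) (hb : Summable b) (n : ℕ → ℕ) :
    (fun z => (gapSeries b n z).re) ∈ harmonicHardyHK := by
  refine mem_harmonicHardyHK_re (differentiableOn_gapSeries hb0 hb n) (C := ∑' k, b k * 2)
    fun r h0 h1 a c _ _ => ?_
  have h := hasSum_integral_slice_gapSeries hb0 hb n h0 h1 (g := fun _ => 1)
    continuous_const (by simp) a c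
  simp only [mul_one] at h
  rw [← h.tsum_eq, ← Real.norm_eq_abs]
  refine tsum_of_norm_bounded (hb.mul_right 2).hasSum fun k => ?_
  rw [mul_assoc, Real.norm_eq_abs, abs_mul, abs_mul, abs_of_nonneg (hb0 k),
    abs_of_nonneg (by positivity : 0 ≤ n k * r ^ n k)]
  refine mul_le_mul_of_nonneg_left ?_ (hb0 k)
  calc (n k * r ^ n k) * |∫ x in a..c, Real.cos (n k * x)|
      = r ^ n k * (n k * |∫ x in a..c, Real.cos (n k * x)|) := by ring
    _ ≤ 1 * 2 := mul_le_mul (pow_le_one₀ h0 h1.le) (mul_abs_integral_cos_le _ _ _)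
        (by positivity) zero_le_one
    _ = 2 := one_mul 2

/-! ### Lower bounds from Fourier coefficients. -/

theorem integral_cos_intCast_mul_nonneg (j : ℤ) :
    0 ≤ ∫ x in (-Real.pi)..Real.pi, Real.cos (j * x) := by
  rcases eq_or_ne j 0 with rfl | hj
  · simp [Real.pi_pos.le]
  · rw [intervalIntegral.integral_comp_mul_left _ (Int.cast_ne_zero.2 hj), integral_cos]
    simp [Real.sin_int_mul_pi]

theorem integral_cos_mul_cos_eq (n m : ℕ) :
    ∫ x in (-Real.pi)..Real.pi, Real.cos (n * x) * Real.cos (m * x) =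
      ((∫ x in (-Real.pi)..Real.pi, Real.cos ((n - m : ℤ) * x)) +
        ∫ x in (-Real.pi)..Real.pi, Real.cos ((n + m : ℤ) * x)) / 2 := by
  rw [← intervalIntegral.integral_add (Continuous.intervalIntegrable (by fun_prop) _ _)
    (Continuous.intervalIntegrable (by fun_prop) _ _), ← intervalIntegral.integral_div]
  refine intervalIntegral.integral_congr fun x _ => ?_
  push_cast
  rw [sub_mul, add_mul, Real.cos_sub, Real.cos_add]
  ring

/-- Nonnegativity replaces orthogonality: the other terms can be dropped from a lower bound even if
frequencies repeat. -/
theorem integral_cos_mul_cos_nonneg (n m : ℕ) :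
    0 ≤ ∫ x in (-Real.pi)..Real.pi, Real.cos (n * x) * Real.cos (m * x) := by
  rw [integral_cos_mul_cos_eq]
  exact div_nonneg (add_nonneg (by exact_mod_cast integral_cos_intCast_mul_nonneg (n - m))
    (by exact_mod_cast integral_cos_intCast_mul_nonneg (n + m))) zero_le_two

theorem pi_le_integral_cos_mul_cos_self (n : ℕ) :
    Real.pi ≤ ∫ x in (-Real.pi)..Real.pi, Real.cos (n * x) * Real.cos (n * x) := by
  rw [integral_cos_mul_cos_eq]
  have := integral_cos_intCast_mul_nonneg (n + n)
  push_cast at this ⊢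
  simp only [sub_self, zero_mul, Real.cos_zero, intervalIntegral.integral_const, smul_eq_mul]
  linarith

/-- A lower bound for the `L^1` norm of a slice by one of its Fourier coefficients. -/
theorem le_integral_slice_gapSeries_mul_cos {b : ℕ → ℝ} (hb0 : ∀ k, 0 ≤ b k) (hb : Summable b)
    (n : ℕ → ℕ) {r : ℝ} (h0 : 0 ≤ r) (h1 : r < 1) (k : ℕ) :
    b k * (n k * r ^ n k) * Real.pi ≤ ∫ x in (-Real.pi)..Real.pi,
      slice (fun z => (gapSeries b n z).re) r x * Real.cos (n k * x) := by
  have hc : ∀ j, 0 ≤ b j * (n j * r ^ n j) := fun j => mul_nonneg (hb0 j) (by positivity)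
  have h := hasSum_integral_slice_gapSeries hb0 hb n h0 h1
    (g := fun x => Real.cos (n k * x)) (by fun_prop) (fun x => Real.abs_cos_le_one _)
    (-Real.pi) Real.pi
  refine le_trans ?_ (le_hasSum h k fun j _ =>
    mul_nonneg (hc j) (integral_cos_mul_cos_nonneg _ _))
  exact mul_le_mul_of_nonneg_left (pi_le_integral_cos_mul_cos_self _) (hc k)

theorem ofReal_integral_mul_le_sliceLpNorm_mul {u : ℂ → ℝ} {r : ℝ} (hu : Continuous (slice u r))
    {g : ℝ → ℝ} (hg1 : ∀ x, |g x| ≤ 1) {p : ℝ≥0∞} (hp : 1 ≤ p) :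
    ENNReal.ofReal (∫ x in (-Real.pi)..Real.pi, slice u r x * g x) ≤
      sliceLpNorm u p r * ENNReal.ofReal (2 * Real.pi) := by
  have hpi := Real.pi_gt_three
  set μ := volume.restrict (Set.Ioc (-Real.pi) Real.pi) with hμ
  have hμu : μ Set.univ = ENNReal.ofReal (2 * Real.pi) := by
    rw [hμ, Measure.restrict_apply_univ, Real.volume_Ioc]
    congr 1
    ring
  have hH := eLpNorm_le_eLpNorm_mul_rpow_measure_univ (μ := μ) hp hu.aestronglyMeasurable
  have h1 : ENNReal.ofReal (∫ x in (-Real.pi)..Real.pi, slice u r x * g x) ≤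
      eLpNorm (slice u r) 1 μ := by
    rw [intervalIntegral.integral_of_le (by linarith), eLpNorm_one_eq_lintegral_enorm]
    refine (ENNReal.ofReal_le_ofReal (le_abs_self _)).trans ?_
    rw [← Real.enorm_eq_ofReal_abs]
    refine (enorm_integral_le_lintegral_enorm _).trans (lintegral_mono fun x => ?_)
    rw [Real.enorm_eq_ofReal_abs, Real.enorm_eq_ofReal_abs, abs_mul]
    exact ENNReal.ofReal_le_ofReal (mul_le_of_le_one_right (abs_nonneg _) (hg1 x))
  refine (h1.trans hH).trans (mul_le_mul_right ?_ _)
  rw [hμu]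
  -- Since `2π ≥ 1`, Hölder's exponent `1 - 1 / p` may be raised to 1, making the constant
  -- independent of `p`.
  refine (ENNReal.rpow_le_rpow_of_exponent_le ?_ (y := 1 / (1 : ℝ≥0∞).toReal - 1 / p.toReal)
    (z := 1) ?_).trans (ENNReal.rpow_one _).le
  · rw [ENNReal.one_le_ofReal]; linarith
  · simp

theorem ofReal_le_sliceLpNorm_gapSeries {b : ℕ → ℝ} (hb0 : ∀ k, 0 ≤ b k) (hb : Summable b)
    (n : ℕ → ℕ) {r : ℝ} (h0 : 0 ≤ r) (h1 : r < 1) (k : ℕ) {p : ℝ≥0∞} (hp : 1 ≤ p) :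
    ENNReal.ofReal (b k * (n k * r ^ n k) / 2) ≤
      sliceLpNorm (fun z => (gapSeries b n z).re) p r := by
  have hc := slice_continuous (gapSeries_re_mem hb0 hb n).1.continuousOn h0 h1
  have h := (ENNReal.ofReal_le_ofReal
    (le_integral_slice_gapSeries_mul_cos hb0 hb n h0 h1 k)).trans
    (ofReal_integral_mul_le_sliceLpNorm_mul hc (fun x => Real.abs_cos_le_one (n k * x)) hp)
  have e : b k * (n k * r ^ n k) * Real.pi = b k * (n k * r ^ n k) / 2 * (2 * Real.pi) := by ring
  have hpi : 0 < 2 * Real.pi := by positivity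
  rw [e, ENNReal.ofReal_mul' hpi.le] at h
  exact (ENNReal.mul_le_mul_iff_left (ENNReal.ofReal_pos.2 hpi).ne' ENNReal.ofReal_ne_top).1 h

/-! ### Sharpness for every `p`: choice of frequencies. -/

theorem tendsto_one_sub_inv_two_mul :
    Tendsto (fun n : ℕ => 1 - 1 / (2 * (n : ℝ))) atTop (𝓝[<] 1) := by
  refine tendsto_nhdsWithin_iff.2 ⟨?_, ?_⟩
  · have h : Tendsto (fun n : ℕ => 2 * (n : ℝ)) atTop atTop :=
      tendsto_natCast_atTop_atTop.const_mul_atTop two_pos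
    simpa using (tendsto_const_nhds (x := (1 : ℝ))).sub (tendsto_inv_atTop_zero.comp h)
  · filter_upwards [eventually_gt_atTop 0] with n hn
    have : (0 : ℝ) < n := Nat.cast_pos.2 hn
    rw [Set.mem_Iio, sub_lt_self_iff]
    positivity

/-- Bernoulli's inequality. -/
theorem half_le_one_sub_inv_two_mul_pow {n : ℕ} (hn : 0 < n) :
    1 / 2 ≤ (1 - 1 / (2 * (n : ℝ))) ^ n := by
  have hn' : (1 : ℝ) ≤ n := Nat.one_le_cast.2 hn
  have h1 : 1 / (2 * (n : ℝ)) ≤ 1 := by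
    rw [div_le_one (by positivity)]; linarith
  have h := one_add_mul_le_pow (a := -(1 / (2 * (n : ℝ)))) (by linarith) n
  have e : 1 + (n : ℝ) * -(1 / (2 * (n : ℝ))) = 1 / 2 := by
    field_simp
    norm_num
  rwa [e, ← sub_eq_add_neg] at h

theorem exists_limsup_sliceLpNorm_div_eq_top {p : ℝ≥0∞} (hp : 1 ≤ p) {ψ : ℝ → ℝ}
    (hψ : ∀ r : ℝ, 0 ≤ r → r < 1 → 0 < ψ r)
    (ho : ψ =o[𝓝[<] (1 : ℝ)] fun r : ℝ => 1 / (1 - r)) :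
    ∃ u ∈ harmonicHardyHK,
      limsup (fun r : ℝ => sliceLpNorm u p r / ENNReal.ofReal (ψ r)) (𝓝[<] (1 : ℝ)) = ∞ := by
  -- At this radius `1 / (1 - r) = 2 n`. The factor `4 ^ (-k)` beats the weight `2 ^ (-k)` by `2 ^
  -- k`; the 8 absorbs the 2 in `2 n`, the bound `r ^ n ≥ 1 / 2` and the halved coefficient.
  have hex : ∀ k : ℕ, ∃ n : ℕ, k < n ∧
      ψ (1 - 1 / (2 * (n : ℝ))) ≤ (1 / 4) ^ k / 8 * (2 * n) := by
    intro k
    have h := (ho.def (c := (1 / 4) ^ k / 8) (by positivity))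
    obtain ⟨n, hn, hk⟩ := ((tendsto_one_sub_inv_two_mul.eventually h).and
      (eventually_gt_atTop k)).exists
    refine ⟨n, hk, (le_abs_self _).trans (hn.trans (le_of_eq ?_))⟩
    rw [sub_sub_cancel, one_div_one_div, Real.norm_of_nonneg (by positivity)]
  choose n hkn hψn using hex
  set b : ℕ → ℝ := fun k => (1 / 2) ^ k with hb
  have hb0 : ∀ k, 0 ≤ b k := fun k => by positivity
  have hbs : Summable b := summable_geometric_of_lt_one (by norm_num) (by norm_num)
  set r : ℕ → ℝ := fun k => 1 - 1 / (2 * (n k : ℝ)) with hr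
  have hrt : Tendsto r atTop (𝓝[<] 1) :=
    tendsto_one_sub_inv_two_mul.comp
      (tendsto_atTop_mono (fun k => (hkn k).le) tendsto_id)
  have hn1 : ∀ k, (1 : ℝ) ≤ n k := fun k => Nat.one_le_cast.2 ((Nat.zero_le k).trans_lt (hkn k))
  have hr0 : ∀ k, 0 ≤ r k := fun k => by
    have := hn1 k
    rw [hr, sub_nonneg, div_le_one (by positivity)]
    linarith
  have hr1 : ∀ k, r k < 1 := fun k => by
    have := hn1 k
    rw [hr, sub_lt_self_iff]
    positivity
  refine ⟨_, gapSeries_re_mem hb0 hbs n, ?_⟩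
  have hlow : ∀ k, ENNReal.ofReal (2 ^ k) ≤
      sliceLpNorm (fun z => (gapSeries b n z).re) p (r k) / ENNReal.ofReal (ψ (r k)) := by
    intro k
    have hpos := hψ _ (hr0 k) (hr1 k)
    rw [ENNReal.le_div_iff_mul_le (Or.inl (ENNReal.ofReal_pos.2 hpos).ne')
      (Or.inl ENNReal.ofReal_ne_top), ← ENNReal.ofReal_mul (by positivity)]
    refine le_trans (ENNReal.ofReal_le_ofReal ?_)
      (ofReal_le_sliceLpNorm_gapSeries hb0 hbs n (hr0 k) (hr1 k) k hp)
    have hpow := half_le_one_sub_inv_two_mul_pow ((Nat.zero_le k).trans_lt (hkn k))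
    have e : (2 : ℝ) ^ k * (1 / 4) ^ k = (1 / 2) ^ k := by
      rw [← mul_pow]; norm_num
    calc (2 : ℝ) ^ k * ψ (r k) ≤ 2 ^ k * ((1 / 4) ^ k / 8 * (2 * n k)) :=
          mul_le_mul_of_nonneg_left (hψn k) (by positivity)
      _ = b k * (n k * (1 / 2)) / 2 := by simp only [hb, ← e]; ring
      _ ≤ b k * (n k * r k ^ n k) / 2 := by
          have := hb0 k
          gcongr
  refine ENNReal.eq_top_of_forall_nnreal_le fun C => ?_
  refine le_limsup_of_frequently_le' (hrt.frequently (Eventually.frequently ?_))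
  filter_upwards [(tendsto_pow_atTop_atTop_of_one_lt (one_lt_two (α := ℝ))).eventually_ge_atTop
    (C : ℝ)] with k hk
  refine le_trans ?_ (hlow k)
  rw [← ENNReal.ofReal_coe_nnreal]
  exact ENNReal.ofReal_le_ofReal hk

theorem mainTheorem6 :
    -- the estimates
    (∀ p : ℝ≥0∞, 1 ≤ p → ∀ u ∈ harmonicHardyHK,
      (∀ r : ℝ, 1 / 2 ≤ r → r < 1 →
        sliceLpNorm u p r ≤
          ENNReal.ofReal (periodFactor p * (2 * r / (Real.pi * (1 - r)))) * hkNorm u) ∧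
      (∀ r : ℝ, 0 ≤ r → r ≤ 1 / 2 →
        sliceLpNorm u p r ≤
          ENNReal.ofReal (periodFactor p * (2 / Real.pi)) * hkNorm u)) ∧
    -- sharpness of the order `1 / (1 - r)` as `r → 1`, for each `p`
    (∀ p : ℝ≥0∞, 1 ≤ p → ∀ ψ : ℝ → ℝ, (∀ r : ℝ, 0 ≤ r → r < 1 → 0 < ψ r) →
      ψ =o[𝓝[<] (1 : ℝ)] (fun r : ℝ => 1 / (1 - r)) →
      ∃ u ∈ harmonicHardyHK,
        limsup (fun r : ℝ => sliceLpNorm u p r / ENNReal.ofReal (ψ r)) (𝓝[<] (1 : ℝ)) = ∞) ∧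
    -- for `p = ∞` the order `1 / (1 - r)` is attained
    (∃ u ∈ harmonicHardyHK, ∃ c : ℝ, 0 < c ∧ ∀ r : ℝ, 0 ≤ r → r < 1 →
      ENNReal.ofReal (c / (1 - r)) ≤ sliceLpNorm u ∞ r) :=
  ⟨fun p _ _ hu => ⟨fun _ => sliceLpNorm_le_of_half_le hu p,
    fun _ => sliceLpNorm_le_of_le_half hu p⟩,
    fun _ hp _ => exists_limsup_sliceLpNorm_div_eq_top hp, exists_sliceLpNorm_top_ge⟩
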